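/- Let $N\ge 3$, let $\Omega\subset\mathbb R^N$ be a bounded open set, and let $1<p<N$, $q>0$, $\mu>0$ and $k>N/p$ be real numbers. Let $W_0^{1,p}(\Omega)$ be the closure of $C_c^\infty(\Omega)$ in $W^{1,p}(\Omega)$, with the norm $\|v\|=\left(\int_\Omega|\nabla v|^p\right)^{1/p}$, and write $\|\cdot\|_k$ for the norm of $L^k(\Omega)$. For $s>-1/\mu$ put $$g(s)=\frac{(p-1)^{q-p+1}}{\mu^q}(1+\mu s)^{p-1}\,|\ln(1+\mu s)|^{q-1}\ln(1+\mu s),\qquad f(s)=\frac{(1+\mu s)^{p-1}}{(p-1)^{p-1}},$$ and put $g(s)=f(s)=0$ for $s\le -1/\mu$ (the continuous extension by zero). Let $G(s)=\int_0^s g(t)\,dt$ and $F(s)=\int_0^s f(t)\,dt$. For $c,h\in L^k(\Omega)$ let $$I(v)=\frac1p\int_\Omega|\nabla v|^p-\int_\Omega c(x)\,G(v)\,dx-\int_\Omega h(x)\,F(v)\,dx,\qquad v\in W_0^{1,p}(\Omega).$$ Then there is $\delta>0$, depending only on $N,\Omega,p,q,\mu,k$, such that for all $c,h\in L^k(\Omega)$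 with $c\ge 0$ a.e. in $\Omega$, $c$ not a.e. equal to $0$, $\|c\|_k<\delta$ and $\|h\|_k<\delta$, the functional $I$ is well defined on $W_0^{1,p}(\Omega)$ (that is, $c\,G(v)$ and $h\,F(v)$ are integrable on $\Omega$ for every $v\in W_0^{1,p}(\Omega)$), and the following hold. 1. There are $\rho>0$ and $\beta>0$ such that $I(v)\ge\beta$ for all $v\in W_0^{1,p}(\Omega)$ with $\|v\|=\rho$; and, for the same $\rho$, there is $v_0\in W_0^{1,p}(\Omega)$ with $\|v_0\|>\rho$ and $I(v_0)\le 0$. 2. For every $v\in W_0^{1,p}(\Omega)$ with $v\ge 0$ a.e. in $\Omega$ and $cv$ not a.e. equal to $0$, one has $I(tv)\to-\infty$ as $t\to+\infty$. -/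

import Mathlib

open MeasureTheory Filter Topology
open scoped ContDiff ENNReal

namespace PGradient

noncomputable section

/-- Makes `L^p` a normed space for a real exponent `p > 1`. -/
instance factOneLeOfReal (p : ℝ) [hp : Fact (1 < p)] : Fact (1 ≤ ENNReal.ofReal p) :=
  ⟨by simpa using hp.out.le⟩

/-- Test functions: `C_c^∞(Ω)`, extended by zero outside `Ω`. -/
def IsTestFunction {N : ℕ} (Ω : Set (EuclideanSpace ℝ (Fin N)))
    (φ : EuclideanSpace ℝ (Fin N) → ℝ) : Prop :=
  ContDiff ℝ ∞ φ ∧ HasCompactSupport φ ∧ tsupport φ ⊆ Ω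

/-- The pairs `(φ, ∇φ)` with `φ ∈ C_c^∞(Ω)`, as elements of `L^p(Ω) × L^p(Ω; ℝ^N)`. -/
def testPairs {N : ℕ} (Ω : Set (EuclideanSpace ℝ (Fin N))) (p : ℝ) :
    Set (Lp ℝ (ENNReal.ofReal p) (volume.restrict Ω) ×
      Lp (EuclideanSpace ℝ (Fin N)) (ENNReal.ofReal p) (volume.restrict Ω)) :=
  {z | ∃ φ : EuclideanSpace ℝ (Fin N) → ℝ, IsTestFunction Ω φ ∧
    z.1 =ᵐ[volume.restrict Ω] φ ∧ z.2 =ᵐ[volume.restrict Ω] gradient φ}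

/-- `W_0^{1,p}(Ω)`: the closure of `C_c^∞(Ω)` in the Sobolev norm. A Sobolev function `v` is
represented by the pair `(v, ∇v)` of `L^p` classes, so that the Sobolev norm is (equivalent to) the
norm of `L^p × L^p`; the second component of an element of the closure is the weak gradient of the
first, because weak gradients are stable under `L^p` limits. -/
def W01p {N : ℕ} (Ω : Set (EuclideanSpace ℝ (Fin N))) (p : ℝ) [Fact (1 < p)] :
    Submodule ℝ (Lp ℝ (ENNReal.ofReal p) (volume.restrict Ω) ×
      Lp (EuclideanSpace ℝ (Fin N)) (ENNReal.ofReal p) (volume.restrict Ω)) :=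
  (Submodule.span ℝ (testPairs Ω p)).topologicalClosure

variable {N : ℕ} {Ω : Set (EuclideanSpace ℝ (Fin N))} {p : ℝ} [Fact (1 < p)]

/-- The function underlying an element of `W_0^{1,p}(Ω)`. -/
def fn (v : W01p Ω p) : EuclideanSpace ℝ (Fin N) → ℝ := v.1.1

/-- The weak gradient of an element of `W_0^{1,p}(Ω)`. -/
def grad (v : W01p Ω p) : EuclideanSpace ℝ (Fin N) → EuclideanSpace ℝ (Fin N) := v.1.2

/-- The Poincaré norm `(∫_Ω |∇v|^p)^{1/p}`. -/
def poincareNorm (v : W01p Ω p) : ℝ := (∫ x in Ω, ‖grad v x‖ ^ p) ^ (1 / p)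

/-- The nonlinearity `g`, extended from `(-1/μ, ∞)` to `ℝ` by zero (its limit at `-1/μ`). -/
def g (p q μ s : ℝ) : ℝ :=
  if -1 / μ < s then
    (p - 1) ^ (q - p + 1) / μ ^ q * (1 + μ * s) ^ (p - 1)
      * |Real.log (1 + μ * s)| ^ (q - 1) * Real.log (1 + μ * s)
  else 0

/-- The nonlinearity `f`, extended from `(-1/μ, ∞)` to `ℝ` by zero (its limit at `-1/μ`). -/
def f (p μ s : ℝ) : ℝ :=
  if -1 / μ < s then (1 + μ * s) ^ (p - 1) / (p - 1) ^ (p - 1) else 0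

/-- The primitive of `g` vanishing at `0`. -/
def G (p q μ s : ℝ) : ℝ := ∫ t in (0 : ℝ)..s, g p q μ t

/-- The primitive of `f` vanishing at `0`. -/
def F (p μ s : ℝ) : ℝ := ∫ t in (0 : ℝ)..s, f p μ t

/-- The functional `I(v) = (1/p) ∫_Ω |∇v|^p - ∫_Ω c G(v) - ∫_Ω h F(v)` on `W_0^{1,p}(Ω)`. -/
def energy (q μ : ℝ) (c h : EuclideanSpace ℝ (Fin N) → ℝ) (v : W01p Ω p) : ℝ :=
  1 / p * (∫ x in Ω, ‖grad v x‖ ^ p) - (∫ x in Ω, c x * G p q μ (fn v x))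
    - ∫ x in Ω, h x * F p μ (fn v x)

end

end PGradient

/-!
Since `k > N / p`, Hölder's inequality and the Sobolev embedding `W_0^{1,p} ⊂ L^{p*}` make
`|c| (1 + |v|)^r` integrable for `r = p* / k'`, with an integral at most `‖c‖_k` times a constant
on each sphere `‖v‖ = ρ`; the point is that `r > p`. The primitives `G` and `F` grow at most like
`s^p` up to a logarithm, so they are `O((1 + |s|)^r)`, and on a fixed sphere the Dirichlet term
`ρ^p / p` dominates as soon as `‖c‖_k` and `‖h‖_k` are small. Along a ray `t v` with `v ≥ 0`, the
Dirichlet and `F` terms are `O(t^p)`, while the logarithm gives `G(s) / s^p → ∞`; Chebyshev's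
inequality on a set `{c ≥ η, v ≥ η}` of positive measure then forces the energy to `-∞`. A bump
function supported where `c` does not vanish provides such a `v`, hence the far point `v₀`.
-/

namespace PGradient

open Asymptotics

section Growth

theorem isBigO_one_add_abs_rpow_mono {a b : ℝ} (hab : a ≤ b) :
    (fun s : ℝ ↦ (1 + |s|) ^ a) =O[⊤] fun s ↦ (1 + |s|) ^ b := by
  refine isBigO_top.2 ⟨1, fun s ↦ ?_⟩
  rw [one_mul, Real.norm_of_nonneg (by positivity), Real.norm_of_nonneg (by positivity)]
  exact Real.rpow_le_rpow_of_exponent_le (le_add_of_nonneg_right (abs_nonneg s)) hab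

theorem intervalIntegrable_of_isBigO {φ : ℝ → ℝ} {a : ℝ} (hφ : Measurable φ)
    (h : φ =O[⊤] fun s ↦ (1 + |s|) ^ a) (x y : ℝ) : IntervalIntegrable φ volume x y := by
  obtain ⟨C, hC⟩ := isBigO_top.1 h
  have hcont : Continuous fun s : ℝ ↦ C * ‖(1 + |s|) ^ a‖ :=
    continuous_const.mul (((continuous_const.add continuous_abs).rpow_const
      fun s ↦ Or.inl (show 0 < 1 + |s| by positivity).ne').norm)
  exact (hcont.intervalIntegrable x y).mono_fun hφ.aestronglyMeasurable
    (Eventually.of_forall fun s ↦ (hC s).trans (le_abs_self _))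

theorem primitive_isBigO {φ : ℝ → ℝ} {a : ℝ} (ha : 1 ≤ a)
    (h : φ =O[⊤] fun s ↦ (1 + |s|) ^ (a - 1)) :
    (fun s ↦ ∫ t in (0 : ℝ)..s, φ t) =O[⊤] fun s ↦ (1 + |s|) ^ a := by
  have : 0 ≤ a - 1 := sub_nonneg.2 ha
  obtain ⟨C, hC0, hC⟩ := h.exists_nonneg
  rw [isBigOWith_top] at hC
  refine isBigO_top.2 ⟨C, fun s ↦ ?_⟩
  have hbound : ∀ t ∈ Set.uIoc 0 s, ‖φ t‖ ≤ C * (1 + |s|) ^ (a - 1) := fun t ht ↦ by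
    have hts : |t| ≤ |s| := by
      simpa using Set.abs_sub_left_of_mem_uIcc (Set.uIoc_subset_uIcc ht)
    calc ‖φ t‖ ≤ C * (1 + |t|) ^ (a - 1) := by
          simpa only [Real.norm_of_nonneg (Real.rpow_nonneg (show 0 ≤ 1 + |t| by positivity) _)]
            using hC t
      _ ≤ C * (1 + |s|) ^ (a - 1) := by gcongr
  calc ‖∫ t in (0 : ℝ)..s, φ t‖ ≤ C * (1 + |s|) ^ (a - 1) * |s - 0| :=
        intervalIntegral.norm_integral_le_of_norm_le_const hbound
    _ ≤ C * (1 + |s|) ^ (a - 1) * (1 + |s|) := by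
        gcongr
        simp
    _ = C * ‖(1 + |s|) ^ a‖ := by
        rw [Real.norm_of_nonneg (by positivity), mul_assoc, ← Real.rpow_add_one (by positivity),
          sub_add_cancel]

theorem abs_log_rpow_le {ε q u : ℝ} (hε : 0 < ε) (hq : 0 < q) (hu : 0 < u) :
    |Real.log u| ^ q ≤ (q / ε) ^ q * max u u⁻¹ ^ ε := by
  have hm : 0 < max u u⁻¹ := hu.trans_le (le_max_left _ _)
  have hlog : |Real.log u| = Real.log (max u u⁻¹) := by
    rw [abs_eq_max_neg, ← Real.log_inv]
    exact (Real.strictMonoOn_log.monotoneOn.map_max hu (inv_pos.2 hu)).symm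
  calc |Real.log u| ^ q ≤ (max u u⁻¹ ^ (ε / q) / (ε / q)) ^ q := by
        refine Real.rpow_le_rpow (abs_nonneg _) ?_ hq.le
        rw [hlog]
        exact Real.log_le_rpow_div hm.le (by positivity)
    _ = (q / ε) ^ q * max u u⁻¹ ^ ε := by
        rw [Real.div_rpow (by positivity) (by positivity), ← Real.rpow_mul hm.le,
          div_mul_cancel₀ _ hq.ne', div_eq_inv_mul, ← Real.inv_rpow (by positivity), inv_div]

-- The logarithm costs a factor `u ^ ε` at infinity and `u ^ (-ε)` at zero; `u ^ a` absorbs the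
-- latter.
theorem rpow_mul_abs_log_rpow_le {a ε q u : ℝ} (hε : 0 < ε) (hεa : ε ≤ a) (hq : 0 < q)
    (hu : 0 < u) : u ^ a * |Real.log u| ^ q ≤ (q / ε) ^ q * (1 + u) ^ (a + ε) := by
  have hmax : u ^ a * max u u⁻¹ ^ ε ≤ (1 + u) ^ (a + ε) := by
    rcases le_total u⁻¹ u with h | h
    · rw [max_eq_left h, ← Real.rpow_add hu]
      exact Real.rpow_le_rpow hu.le (by linarith) (by linarith)
    · rw [max_eq_right h, Real.inv_rpow hu.le, ← Real.rpow_neg hu.le, ← Real.rpow_add hu]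
      calc u ^ (a + -ε) ≤ (1 + u) ^ (a + -ε) :=
            Real.rpow_le_rpow hu.le (by linarith) (by linarith)
        _ ≤ (1 + u) ^ (a + ε) :=
            Real.rpow_le_rpow_of_exponent_le (by linarith) (by linarith)
  calc u ^ a * |Real.log u| ^ q ≤ u ^ a * ((q / ε) ^ q * max u u⁻¹ ^ ε) := by
        gcongr
        exact abs_log_rpow_le hε hq hu
    _ = (q / ε) ^ q * (u ^ a * max u u⁻¹ ^ ε) := by ring
    _ ≤ (q / ε) ^ q * (1 + u) ^ (a + ε) := by gcongr

theorem abs_rpow_sub_one_mul_abs {q : ℝ} (hq : q ≠ 0) (x : ℝ) :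
    |x| ^ (q - 1) * |x| = |x| ^ q := by
  rcases eq_or_ne x 0 with rfl | hx
  · simp [hq]
  · rw [← Real.rpow_add_one (abs_ne_zero.2 hx), sub_add_cancel]

theorem one_add_mul_pos_iff {μ s : ℝ} (hμ : 0 < μ) : 0 < 1 + μ * s ↔ -1 / μ < s := by
  rw [div_lt_iff₀ hμ, neg_lt_iff_pos_add', mul_comm]

theorem two_add_mul_le {μ s : ℝ} (hμ : 0 ≤ μ) : 2 + μ * s ≤ (2 + μ) * (1 + |s|) := by
  nlinarith [le_abs_self s, abs_nonneg s]

end Growth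

section Nonlinearities

variable {p q μ : ℝ}

theorem measurable_g (p q μ : ℝ) : Measurable (g p q μ) := by
  unfold g
  refine Measurable.ite measurableSet_Ioi ?_ measurable_const
  have : Measurable fun s : ℝ ↦ |Real.log (1 + μ * s)| := by
    exact (Real.measurable_log.comp (by fun_prop : Measurable fun s : ℝ ↦ 1 + μ * s)).norm
  fun_prop

theorem measurable_f (p μ : ℝ) : Measurable (f p μ) :=
  Measurable.ite measurableSet_Ioi (by fun_prop) measurable_const

theorem abs_g_le (hp : 1 < p) (hq : 0 < q) (hμ : 0 < μ) {ε : ℝ} (hε : 0 < ε) (hεp : ε ≤ p - 1)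
    (s : ℝ) :
    |g p q μ s| ≤ (p - 1) ^ (q - p + 1) / μ ^ q * ((q / ε) ^ q * (2 + μ) ^ (p - 1 + ε)) *
      (1 + |s|) ^ (p - 1 + ε) := by
  have : 0 < p - 1 := sub_pos.2 hp
  unfold g
  split_ifs with hs
  · have hu := (one_add_mul_pos_iff hμ).2 hs
    have hA : 0 ≤ (p - 1) ^ (q - p + 1) / μ ^ q := by positivity
    rw [abs_mul, abs_of_nonneg (a := _ * _ ^ (q - 1)) (by positivity), mul_assoc,
      abs_rpow_sub_one_mul_abs hq.ne', mul_assoc, mul_assoc]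
    refine mul_le_mul_of_nonneg_left ?_ hA
    calc (1 + μ * s) ^ (p - 1) * |Real.log (1 + μ * s)| ^ q
        ≤ (q / ε) ^ q * (1 + (1 + μ * s)) ^ (p - 1 + ε) := rpow_mul_abs_log_rpow_le hε hεp hq hu
      _ ≤ (q / ε) ^ q * ((2 + μ) * (1 + |s|)) ^ (p - 1 + ε) := by
          gcongr
          linarith [two_add_mul_le (s := s) hμ.le]
      _ = _ := by rw [Real.mul_rpow (by positivity) (by positivity), mul_assoc]
  · rw [abs_zero]
    positivity

theorem g_isBigO (hp : 1 < p) (hq : 0 < q) (hμ : 0 < μ) {r : ℝ} (hr : p - 1 < r) :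
    g p q μ =O[⊤] fun s ↦ (1 + |s|) ^ r := by
  have hε : 0 < min (p - 1) (r - (p - 1)) := lt_min (sub_pos.2 hp) (sub_pos.2 hr)
  have hg : g p q μ =O[⊤] fun s ↦ (1 + |s|) ^ (p - 1 + min (p - 1) (r - (p - 1))) :=
    isBigO_top.2 ⟨_, fun s ↦ (abs_g_le hp hq hμ hε (min_le_left _ _) s).trans_eq
      (by rw [Real.norm_of_nonneg (by positivity)])⟩
  exact hg.trans (isBigO_one_add_abs_rpow_mono (by linarith [min_le_right (p - 1) (r - (p - 1))]))

theorem f_isBigO (hp : 1 < p) (hμ : 0 < μ) : f p μ =O[⊤] fun s ↦ (1 + |s|) ^ (p - 1) := by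
  have : 0 < p - 1 := sub_pos.2 hp
  refine isBigO_top.2 ⟨(2 + μ) ^ (p - 1) / (p - 1) ^ (p - 1), fun s ↦ ?_⟩
  unfold f
  split_ifs with hs
  · have hu := (one_add_mul_pos_iff hμ).2 hs
    rw [Real.norm_of_nonneg (by positivity), Real.norm_of_nonneg (by positivity),
      div_mul_eq_mul_div, ← Real.mul_rpow (by positivity) (by positivity)]
    gcongr
    linarith [two_add_mul_le (s := s) hμ.le]
  · rw [norm_zero]
    positivity

theorem continuous_G (hp : 1 < p) (hq : 0 < q) (hμ : 0 < μ) : Continuous (G p q μ) :=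
  intervalIntegral.continuous_primitive
    (intervalIntegrable_of_isBigO (measurable_g p q μ) (g_isBigO hp hq hμ (sub_one_lt p))) 0

theorem continuous_F (hp : 1 < p) (hμ : 0 < μ) : Continuous (F p μ) :=
  intervalIntegral.continuous_primitive
    (intervalIntegrable_of_isBigO (measurable_f p μ) (f_isBigO hp hμ)) 0

theorem G_isBigO (hp : 1 < p) (hq : 0 < q) (hμ : 0 < μ) {r : ℝ} (hr : p < r) :
    G p q μ =O[⊤] fun s ↦ (1 + |s|) ^ r :=
  primitive_isBigO (hp.trans hr).le (g_isBigO hp hq hμ (sub_lt_sub_right hr 1))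

theorem F_isBigO (hp : 1 < p) (hμ : 0 < μ) : F p μ =O[⊤] fun s ↦ (1 + |s|) ^ p :=
  primitive_isBigO hp.le (f_isBigO hp hμ)

end Nonlinearities

section MonotonePrimitive

variable {φ : ℝ → ℝ}

theorem intervalIntegrable_of_monotoneOn (hφ : MonotoneOn φ (Set.Ici 0)) {s t : ℝ} (hs : 0 ≤ s)
    (ht : 0 ≤ t) : IntervalIntegrable φ volume s t :=
  (hφ.mono fun _ hx ↦ (le_min hs ht).trans hx.1).intervalIntegrable

theorem nonneg_of_monotoneOn (hφ : MonotoneOn φ (Set.Ici 0)) (hφ0 : 0 ≤ φ 0) {s : ℝ}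
    (hs : 0 ≤ s) : 0 ≤ φ s :=
  hφ0.trans (hφ Set.self_mem_Ici hs hs)

theorem monotoneOn_primitive (hφ : MonotoneOn φ (Set.Ici 0)) (hφ0 : 0 ≤ φ 0) :
    MonotoneOn (fun s ↦ ∫ x in (0 : ℝ)..s, φ x) (Set.Ici 0) := by
  intro s hs t ht hst
  rw [← sub_nonneg, intervalIntegral.integral_interval_sub_left
    (intervalIntegrable_of_monotoneOn hφ le_rfl ht)
    (intervalIntegrable_of_monotoneOn hφ le_rfl hs)]
  exact intervalIntegral.integral_nonneg hst fun x hx ↦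
    nonneg_of_monotoneOn hφ hφ0 (le_trans hs hx.1)

theorem half_mul_le_primitive (hφ : MonotoneOn φ (Set.Ici 0)) (hφ0 : 0 ≤ φ 0) {s : ℝ}
    (hs : 0 ≤ s) : s / 2 * φ (s / 2) ≤ ∫ x in (0 : ℝ)..s, φ x := by
  have hs2 : 0 ≤ s / 2 := div_nonneg hs two_pos.le
  have hleft := intervalIntegrable_of_monotoneOn hφ le_rfl hs2
  have hright := intervalIntegrable_of_monotoneOn hφ hs2 hs
  calc s / 2 * φ (s / 2) = ∫ _ in (s / 2)..s, φ (s / 2) := by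
        rw [intervalIntegral.integral_const, smul_eq_mul, sub_half]
    _ ≤ ∫ x in (s / 2)..s, φ x :=
        intervalIntegral.integral_mono_on (half_le_self hs) (by simp) hright
          fun x hx ↦ hφ hs2 (hs2.trans hx.1) hx.1
    _ ≤ (∫ x in (0 : ℝ)..(s / 2), φ x) + ∫ x in (s / 2)..s, φ x :=
        le_add_of_nonneg_left <| intervalIntegral.integral_nonneg hs2
          fun x hx ↦ nonneg_of_monotoneOn hφ hφ0 hx.1
    _ = ∫ x in (0 : ℝ)..s, φ x := intervalIntegral.integral_add_adjacent_intervals hleft hright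

theorem tendsto_primitive_div_rpow_atTop (hφ : MonotoneOn φ (Set.Ici 0)) (hφ0 : 0 ≤ φ 0) {a : ℝ}
    (h : Tendsto (fun s ↦ φ s / s ^ (a - 1)) atTop atTop) :
    Tendsto (fun s ↦ (∫ x in (0 : ℝ)..s, φ x) / s ^ a) atTop atTop := by
  have hhalf : Tendsto (fun s : ℝ ↦ s / 2) atTop atTop := tendsto_id.atTop_div_const two_pos
  have hconst : (0 : ℝ) < (2 ^ a)⁻¹ := by positivity
  refine tendsto_atTop_mono' _ ?_ ((h.comp hhalf).const_mul_atTop hconst)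
  filter_upwards [eventually_gt_atTop 0] with s hs
  calc (2 ^ a)⁻¹ * (φ (s / 2) / (s / 2) ^ (a - 1)) = s / 2 * φ (s / 2) / s ^ a := by
        rw [Real.rpow_sub_one (by positivity), Real.div_rpow hs.le two_pos.le]
        field_simp
    _ ≤ (∫ x in (0 : ℝ)..s, φ x) / s ^ a := by
        gcongr
        exact half_mul_le_primitive hφ hφ0 hs.le

end MonotonePrimitive

section Superlinearity

variable {p q μ : ℝ}

theorem log_one_add_mul_nonneg (hμ : 0 ≤ μ) {s : ℝ} (hs : 0 ≤ s) :
    0 ≤ Real.log (1 + μ * s) :=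
  Real.log_nonneg (le_add_of_nonneg_right (mul_nonneg hμ hs))

theorem g_eq_of_nonneg (hq : 0 < q) (hμ : 0 < μ) {s : ℝ} (hs : 0 ≤ s) :
    g p q μ s = (p - 1) ^ (q - p + 1) / μ ^ q * (1 + μ * s) ^ (p - 1)
      * Real.log (1 + μ * s) ^ q := by
  have hl := log_one_add_mul_nonneg hμ.le hs
  have h := abs_rpow_sub_one_mul_abs hq.ne' (Real.log (1 + μ * s))
  rw [abs_of_nonneg hl] at h
  rw [g, if_pos ((one_add_mul_pos_iff hμ).1 (by positivity)), mul_assoc, abs_of_nonneg hl, h]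

theorem g_zero (hq : 0 < q) (hμ : 0 < μ) : g p q μ 0 = 0 := by
  simp [g_eq_of_nonneg hq hμ le_rfl, hq.ne']

theorem g_monotoneOn (hp : 1 ≤ p) (hq : 0 < q) (hμ : 0 < μ) :
    MonotoneOn (g p q μ) (Set.Ici 0) := by
  intro s (hs : 0 ≤ s) t (ht : 0 ≤ t) hst
  have : 0 ≤ p - 1 := sub_nonneg.2 hp
  have hlog := log_one_add_mul_nonneg hμ.le hs
  rw [g_eq_of_nonneg hq hμ hs, g_eq_of_nonneg hq hμ ht]
  gcongr

theorem tendsto_g_div_rpow_atTop (hp : 1 < p) (hq : 0 < q) (hμ : 0 < μ) :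
    Tendsto (fun s ↦ g p q μ s / s ^ (p - 1)) atTop atTop := by
  have : 0 < p - 1 := sub_pos.2 hp
  have hK : 0 < (p - 1) ^ (q - p + 1) / μ ^ q * μ ^ (p - 1) := by positivity
  have hlog : Tendsto (fun s ↦ Real.log (1 + μ * s) ^ q) atTop atTop :=
    (tendsto_rpow_atTop hq).comp <| Real.tendsto_log_atTop.comp <|
      tendsto_atTop_add_const_left _ 1 (tendsto_id.const_mul_atTop hμ)
  refine tendsto_atTop_mono' _ ?_ (hlog.const_mul_atTop hK)
  filter_upwards [eventually_gt_atTop 0] with s hs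
  have hlog0 := log_one_add_mul_nonneg hμ.le hs.le
  rw [le_div_iff₀ (by positivity), g_eq_of_nonneg hq hμ hs.le]
  calc _ = (p - 1) ^ (q - p + 1) / μ ^ q * (μ * s) ^ (p - 1) * Real.log (1 + μ * s) ^ q := by
        rw [Real.mul_rpow hμ.le hs.le]
        ring
    _ ≤ _ := by
        gcongr
        linarith

theorem G_monotoneOn (hp : 1 ≤ p) (hq : 0 < q) (hμ : 0 < μ) :
    MonotoneOn (G p q μ) (Set.Ici 0) :=
  monotoneOn_primitive (g_monotoneOn hp hq hμ) (g_zero hq hμ).ge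

theorem tendsto_G_div_rpow_atTop (hp : 1 < p) (hq : 0 < q) (hμ : 0 < μ) :
    Tendsto (fun s ↦ G p q μ s / s ^ p) atTop atTop :=
  tendsto_primitive_div_rpow_atTop (g_monotoneOn hp.le hq hμ) (g_zero hq hμ).ge
    (tendsto_g_div_rpow_atTop hp hq hμ)

end Superlinearity

section WeightedIntegrals

variable {α : Type*} [MeasurableSpace α] {ν : Measure α} {c w : α → ℝ}

theorem memLp_abs_rpow {m r : ℝ} (hr : 0 < r)
    (hw : MemLp w (ENNReal.ofReal (m * r)) ν) :
    MemLp (fun x ↦ |w x| ^ r) (ENNReal.ofReal m) ν := by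
  have h := hw.norm_rpow_div (ENNReal.ofReal r)
  rwa [← ENNReal.ofReal_div_of_pos hr, mul_div_cancel_right₀ m hr.ne',
    ENNReal.toReal_ofReal hr.le] at h

theorem integrable_abs_mul_abs_rpow {k k' r : ℝ} (hk : k.HolderConjugate k') (hr : 0 < r)
    (hc : MemLp c (ENNReal.ofReal k) ν) (hw : MemLp w (ENNReal.ofReal (k' * r)) ν) :
    Integrable (fun x ↦ |c x| * |w x| ^ r) ν := by
  have := hk.ennrealOfReal
  exact memLp_one_iff_integrable.1 ((memLp_abs_rpow hr hw).mul' hc.norm)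

theorem integral_abs_mul_abs_rpow_le {k k' r : ℝ} (hk : k.HolderConjugate k') (hr : 0 < r)
    (hc : MemLp c (ENNReal.ofReal k) ν) (hw : MemLp w (ENNReal.ofReal (k' * r)) ν) :
    ∫ x, |c x| * |w x| ^ r ∂ν ≤
      lpNorm c (ENNReal.ofReal k) ν * lpNorm w (ENNReal.ofReal (k' * r)) ν ^ r := by
  have hk' := hk.symm.pos
  have hint : 0 ≤ ∫ x, ‖w x‖ ^ (k' * r) ∂ν := by positivity
  have holder := integral_mul_norm_le_Lp_mul_Lq hk hc (memLp_abs_rpow hr hw)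
  have hpow : ∀ x, ‖|w x| ^ r‖ ^ k' = ‖w x‖ ^ (k' * r) := fun x ↦ by
    rw [Real.norm_of_nonneg (by positivity), ← Real.rpow_mul (abs_nonneg _), mul_comm,
      Real.norm_eq_abs]
  simp only [hpow] at holder
  rw [lpNorm_eq_integral_norm_rpow_toReal (by simpa using hk.pos) ENNReal.ofReal_ne_top hc.1,
    lpNorm_eq_integral_norm_rpow_toReal (ENNReal.ofReal_pos.2 (by positivity)).ne'
      ENNReal.ofReal_ne_top hw.1,
    ENNReal.toReal_ofReal hk.nonneg, ENNReal.toReal_ofReal (by positivity), ← Real.rpow_mul hint,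
    mul_inv, inv_mul_cancel_right₀ hr.ne', ← one_div, ← one_div]
  simpa only [Real.norm_of_nonneg (Real.rpow_nonneg (abs_nonneg _) r), Real.norm_eq_abs]
    using holder

theorem abs_one_add_abs (s : ℝ) : |(1 + |s|)| = 1 + |s| :=
  abs_of_nonneg (by positivity)

theorem memLp_one_add_abs [IsFiniteMeasure ν] {m : ℝ≥0∞} (hw : MemLp w m ν) :
    MemLp (fun x ↦ 1 + |w x|) m ν :=
  (memLp_const (1 : ℝ)).add hw.abs

theorem lpNorm_one_add_abs_le [IsFiniteMeasure ν] {m : ℝ≥0∞} (hm : 1 ≤ m) (hw : MemLp w m ν) :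
    lpNorm (fun x ↦ 1 + |w x|) m ν ≤ lpNorm (fun _ ↦ (1 : ℝ)) m ν + lpNorm w m ν := by
  rw [← lpNorm_fun_abs hw.1]
  exact lpNorm_add_le (memLp_const 1) hm

theorem integrable_mul_comp_of_isBigO {ψ : ℝ → ℝ} {r : ℝ} (hψ : Continuous ψ)
    (h : ψ =O[⊤] fun s ↦ (1 + |s|) ^ r) (hc : AEStronglyMeasurable c ν)
    (hw : AEStronglyMeasurable w ν) (hint : Integrable (fun x ↦ |c x| * (1 + |w x|) ^ r) ν) :
    Integrable (fun x ↦ c x * ψ (w x)) ν := by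
  have hbig : (fun x ↦ c x * ψ (w x)) =O[⊤] fun x ↦ |c x| * (1 + |w x|) ^ r :=
    (isBigO_refl c ⊤).abs_right.mul (h.comp_tendsto tendsto_top)
  obtain ⟨C, hC⟩ := isBigO_top.1 hbig
  exact (hint.norm.const_mul C).mono' (hc.mul (hψ.comp_aestronglyMeasurable hw))
    (Eventually.of_forall hC)

theorem exists_abs_integral_mul_comp_le {ψ : ℝ → ℝ} {r : ℝ}
    (h : ψ =O[⊤] fun s ↦ (1 + |s|) ^ r) :
    ∃ C, 0 ≤ C ∧ ∀ c w : α → ℝ, Integrable (fun x ↦ |c x| * (1 + |w x|) ^ r) ν →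
      |∫ x, c x * ψ (w x) ∂ν| ≤ C * ∫ x, |c x| * (1 + |w x|) ^ r ∂ν := by
  obtain ⟨C, hC0, hC⟩ := h.exists_nonneg
  rw [isBigOWith_top] at hC
  refine ⟨C, hC0, fun c w hint ↦ ?_⟩
  rw [← integral_const_mul, ← Real.norm_eq_abs]
  refine norm_integral_le_of_norm_le (hint.const_mul C) (Eventually.of_forall fun x ↦ ?_)
  calc ‖c x * ψ (w x)‖ ≤ |c x| * (C * ‖(1 + |w x|) ^ r‖) := by
        rw [norm_mul, Real.norm_eq_abs (c x)]
        gcongr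
        exact hC _
    _ = C * (|c x| * (1 + |w x|) ^ r) := by
        rw [Real.norm_of_nonneg (by positivity)]
        ring

theorem isBigO_integral_mul_comp_smul {ψ : ℝ → ℝ} {a r : ℝ} (ha : 0 ≤ a) (har : a ≤ r)
    (h : ψ =O[⊤] fun s ↦ (1 + |s|) ^ a)
    (hint : Integrable (fun x ↦ |c x| * (1 + |w x|) ^ r) ν) :
    (fun t : ℝ ↦ ∫ x, c x * ψ (t * w x) ∂ν) =O[atTop] fun t ↦ t ^ a := by
  obtain ⟨C, hC0, hC⟩ := h.exists_nonneg
  rw [isBigOWith_top] at hC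
  refine IsBigO.of_bound (C * ∫ x, |c x| * (1 + |w x|) ^ r ∂ν) ?_
  filter_upwards [eventually_ge_atTop 1] with t ht
  have ht0 : 0 ≤ t := zero_le_one.trans ht
  have hscale : ∀ s, (1 + |t * s|) ^ a ≤ t ^ a * (1 + |s|) ^ r := fun s ↦ calc
    (1 + |t * s|) ^ a ≤ (t * (1 + |s|)) ^ a := by
        rw [abs_mul, abs_of_nonneg ht0, mul_one_add]
        gcongr
    _ = t ^ a * (1 + |s|) ^ a := Real.mul_rpow ht0 (by positivity)
    _ ≤ t ^ a * (1 + |s|) ^ r := by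
        gcongr
        exact le_add_of_nonneg_right (abs_nonneg s)
  rw [Real.norm_of_nonneg (Real.rpow_nonneg ht0 a), mul_right_comm, ← integral_const_mul]
  refine norm_integral_le_of_norm_le (hint.const_mul (C * t ^ a)) (Eventually.of_forall fun x ↦ ?_)
  calc ‖c x * ψ (t * w x)‖ ≤ |c x| * (C * ‖(1 + |t * w x|) ^ a‖) := by
        rw [norm_mul, Real.norm_eq_abs (c x)]
        gcongr
        exact hC _
    _ ≤ |c x| * (C * (t ^ a * (1 + |w x|) ^ r)) := by
        rw [Real.norm_of_nonneg (by positivity)]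
        gcongr
        exact hscale _
    _ = C * t ^ a * (|c x| * (1 + |w x|) ^ r) := by ring

theorem exists_pos_measure_le_and_le (hc : ∀ᵐ x ∂ν, 0 ≤ c x) (hw : ∀ᵐ x ∂ν, 0 ≤ w x)
    (hcw : ¬ ∀ᵐ x ∂ν, c x * w x = 0) :
    ∃ η : ℝ, 0 < η ∧ ν {x | η ≤ c x ∧ η ≤ w x} ≠ 0 := by
  contrapose! hcw
  have hnull : ∀ᵐ x ∂ν, ∀ n : ℕ, ¬ (1 / ((n : ℝ) + 1) ≤ c x ∧ 1 / ((n : ℝ) + 1) ≤ w x) :=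
    ae_all_iff.2 fun n ↦ by simpa [ae_iff] using hcw (1 / ((n : ℝ) + 1)) (by positivity)
  filter_upwards [hc, hw, hnull] with x hcx hwx hx
  by_contra hne
  obtain ⟨hcne, hwne⟩ := mul_ne_zero_iff.1 hne
  obtain ⟨n, hn⟩ := exists_nat_one_div_lt (lt_min (hcx.lt_of_ne' hcne) (hwx.lt_of_ne' hwne))
  exact hx n (le_min_iff.1 hn.le)

theorem mul_measureReal_le_integral_mul_comp [IsFiniteMeasure ν] {Φ : ℝ → ℝ}
    (hΦ : MonotoneOn Φ (Set.Ici 0)) (hΦ0 : 0 ≤ Φ 0) (hc : ∀ᵐ x ∂ν, 0 ≤ c x)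
    (hw : ∀ᵐ x ∂ν, 0 ≤ w x) (hint : Integrable (fun x ↦ c x * Φ (w x)) ν) {a b : ℝ}
    (ha : 0 ≤ a) (hb : 0 ≤ b) :
    a * Φ b * ν.real {x | a ≤ c x ∧ b ≤ w x} ≤ ∫ x, c x * Φ (w x) ∂ν := by
  have hΦb := nonneg_of_monotoneOn hΦ hΦ0 hb
  have hnonneg : 0 ≤ᵐ[ν] fun x ↦ c x * Φ (w x) := by
    filter_upwards [hc, hw] with x hcx hwx
    exact mul_nonneg hcx (nonneg_of_monotoneOn hΦ hΦ0 hwx)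
  have hsub : {x | a ≤ c x ∧ b ≤ w x} ⊆ {x | a * Φ b ≤ c x * Φ (w x)} := fun x ⟨hac, hbw⟩ ↦
    mul_le_mul hac (hΦ hb (hb.trans hbw) hbw) hΦb (ha.trans hac)
  calc a * Φ b * ν.real {x | a ≤ c x ∧ b ≤ w x}
      ≤ a * Φ b * ν.real {x | a * Φ b ≤ c x * Φ (w x)} := by gcongr; exact measure_ne_top _ _
    _ ≤ ∫ x, c x * Φ (w x) ∂ν := mul_meas_ge_le_integral_of_nonneg hnonneg hint _

theorem tendsto_integral_mul_comp_smul_div_rpow_atTop [IsFiniteMeasure ν] {Φ : ℝ → ℝ} {a : ℝ}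
    (hΦ : MonotoneOn Φ (Set.Ici 0)) (hΦ0 : 0 ≤ Φ 0)
    (hlim : Tendsto (fun s ↦ Φ s / s ^ a) atTop atTop) (hc : ∀ᵐ x ∂ν, 0 ≤ c x)
    (hw : ∀ᵐ x ∂ν, 0 ≤ w x) (hcw : ¬ ∀ᵐ x ∂ν, c x * w x = 0)
    (hint : ∀ t : ℝ, Integrable (fun x ↦ c x * Φ (t * w x)) ν) :
    Tendsto (fun t : ℝ ↦ (∫ x, c x * Φ (t * w x) ∂ν) / t ^ a) atTop atTop := by
  obtain ⟨η, hη, hE⟩ := exists_pos_measure_le_and_le hc hw hcw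
  set E := {x | η ≤ c x ∧ η ≤ w x}
  have hEpos : 0 < ν.real E := ENNReal.toReal_pos hE (measure_ne_top _ _)
  have hK : 0 < η * η ^ a * ν.real E := by positivity
  refine tendsto_atTop_mono' _ ?_
    ((hlim.comp (tendsto_id.atTop_mul_const hη)).const_mul_atTop hK)
  filter_upwards [eventually_gt_atTop 0] with t ht
  have hset : {x | η ≤ c x ∧ t * η ≤ t * w x} = E := by
    simp only [mul_le_mul_iff_right₀ ht, E]
  have hwt : ∀ᵐ x ∂ν, 0 ≤ t * w x := hw.mono fun x hx ↦ mul_nonneg ht.le hx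
  have hcheb := mul_measureReal_le_integral_mul_comp hΦ hΦ0 hc hwt (hint t) hη.le
    (mul_nonneg ht.le hη.le)
  rw [hset] at hcheb
  calc η * η ^ a * ν.real E * (Φ (t * η) / (t * η) ^ a)
      = η * Φ (t * η) * ν.real E / t ^ a := by
        rw [Real.mul_rpow ht.le hη.le]
        field_simp
    _ ≤ (∫ x, c x * Φ (t * w x) ∂ν) / t ^ a := by gcongr

theorem eLpNorm_le_of_tendsto_Lp {E : Type*} [NormedAddCommGroup E] {p q : ℝ≥0∞} [Fact (1 ≤ p)]
    {u : ℕ → Lp E p ν} {u₀ : Lp E p ν} {b : ℕ → ℝ≥0∞} {b₀ : ℝ≥0∞}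
    (hu : Tendsto u atTop (𝓝 u₀)) (hb : Tendsto b atTop (𝓝 b₀))
    (hub : ∀ n, eLpNorm (u n) q ν ≤ b n) : eLpNorm u₀ q ν ≤ b₀ := by
  obtain ⟨ns, hns, hae⟩ := (tendstoInMeasure_of_tendsto_Lp hu).exists_seq_tendsto_ae
  calc eLpNorm u₀ q ν ≤ atTop.liminf fun n ↦ eLpNorm (u (ns n)) q ν :=
        Lp.eLpNorm_lim_le_liminf_eLpNorm (fun n ↦ Lp.aestronglyMeasurable (u (ns n))) _ hae
    _ ≤ atTop.liminf fun n ↦ b (ns n) :=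
        liminf_le_liminf (Eventually.of_forall fun n ↦ hub (ns n))
    _ = b₀ := (hb.comp hns.tendsto_atTop).liminf_eq

end WeightedIntegrals

section Gradient

variable {E : Type*} [NormedAddCommGroup E] [InnerProductSpace ℝ E] [CompleteSpace E]
  {φ ψ : E → ℝ}

theorem norm_gradient (φ : E → ℝ) (x : E) : ‖gradient φ x‖ = ‖fderiv ℝ φ x‖ := by
  rw [← toDual_gradient (𝕜 := ℝ), LinearIsometryEquiv.norm_map]

theorem gradient_add (hφ : Differentiable ℝ φ) (hψ : Differentiable ℝ ψ) :
    gradient (φ + ψ) = gradient φ + gradient ψ := by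
  ext1 x
  simp [gradient, fderiv_add (hφ x) (hψ x)]

theorem gradient_const_smul (a : ℝ) (hφ : Differentiable ℝ φ) :
    gradient (a • φ) = a • gradient φ := by
  ext1 x
  simp [gradient, fderiv_const_smul (hφ x) a]

theorem support_gradient_subset_tsupport (φ : E → ℝ) :
    Function.support (gradient φ) ⊆ tsupport φ := fun x hx ↦
  support_fderiv_subset ℝ (by rwa [Function.mem_support, ← norm_ne_zero_iff, ← norm_gradient,
    norm_ne_zero_iff])

end Gradient

section SobolevSpace

variable {N : ℕ} {Ω : Set (EuclideanSpace ℝ (Fin N))} {p : ℝ}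
  {φ ψ : EuclideanSpace ℝ (Fin N) → ℝ}

theorem IsTestFunction.zero : IsTestFunction Ω 0 :=
  ⟨contDiff_const, HasCompactSupport.zero, by simp [tsupport]⟩

theorem IsTestFunction.add (hφ : IsTestFunction Ω φ) (hψ : IsTestFunction Ω ψ) :
    IsTestFunction Ω (φ + ψ) :=
  ⟨hφ.1.add hψ.1, hφ.2.1.add hψ.2.1, (tsupport_add φ ψ).trans (Set.union_subset hφ.2.2 hψ.2.2)⟩

theorem IsTestFunction.const_smul (a : ℝ) (hφ : IsTestFunction Ω φ) :
    IsTestFunction Ω (a • φ) :=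
  ⟨contDiff_const.smul hφ.1, hφ.2.1.smul_left (f := fun _ ↦ a),
    (closure_mono (Function.support_const_smul_subset a φ)).trans hφ.2.2⟩

theorem IsTestFunction.differentiable (hφ : IsTestFunction Ω φ) : Differentiable ℝ φ :=
  hφ.1.differentiable (by simp)

theorem IsTestFunction.continuous_gradient (hφ : IsTestFunction Ω φ) :
    Continuous (gradient φ) :=
  (LinearIsometryEquiv.continuous _).comp (hφ.1.continuous_fderiv (by simp))

theorem IsTestFunction.hasCompactSupport_gradient (hφ : IsTestFunction Ω φ) :
    HasCompactSupport (gradient φ) :=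
  hφ.2.1.mono' (support_gradient_subset_tsupport φ)

theorem mem_span_testPairs_iff
    {z : Lp ℝ (ENNReal.ofReal p) (volume.restrict Ω) ×
      Lp (EuclideanSpace ℝ (Fin N)) (ENNReal.ofReal p) (volume.restrict Ω)} :
    z ∈ Submodule.span ℝ (testPairs Ω p) ↔ z ∈ testPairs Ω p := by
  refine ⟨fun hz ↦ ?_, fun hz ↦ Submodule.subset_span hz⟩
  induction hz using Submodule.span_induction with
  | mem _ hx => exact hx
  | zero =>
    refine ⟨0, .zero, Lp.coeFn_zero _ _ _, ?_⟩
    rw [show gradient (0 : EuclideanSpace ℝ (Fin N) → ℝ) = 0 from gradient_const' 0]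
    exact Lp.coeFn_zero _ _ _
  | add x y _ _ hx hy =>
    obtain ⟨φ, hφ, hxφ, hxφ'⟩ := hx
    obtain ⟨ψ, hψ, hyψ, hyψ'⟩ := hy
    refine ⟨φ + ψ, hφ.add hψ, (Lp.coeFn_add _ _).trans (hxφ.add hyψ), ?_⟩
    rw [gradient_add hφ.differentiable hψ.differentiable]
    exact (Lp.coeFn_add _ _).trans (hxφ'.add hyψ')
  | smul a x _ hx =>
    obtain ⟨φ, hφ, hxφ, hxφ'⟩ := hx
    refine ⟨a • φ, hφ.const_smul a, (Lp.coeFn_smul _ _).trans (hxφ.const_smul a), ?_⟩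
    rw [gradient_const_smul a hφ.differentiable]
    exact (Lp.coeFn_smul _ _).trans (hxφ'.const_smul a)

variable [Fact (1 < p)]

theorem IsTestFunction.exists_fn_ae_eq (hφ : IsTestFunction Ω φ) :
    ∃ v : W01p Ω p, fn v =ᵐ[volume.restrict Ω] φ := by
  have hφLp : MemLp φ (ENNReal.ofReal p) (volume.restrict Ω) :=
    (hφ.1.continuous.memLp_of_hasCompactSupport hφ.2.1).restrict _
  have hgradLp : MemLp (gradient φ) (ENNReal.ofReal p) (volume.restrict Ω) :=
    (hφ.continuous_gradient.memLp_of_hasCompactSupport hφ.hasCompactSupport_gradient).restrict _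
  exact ⟨⟨(hφLp.toLp φ, hgradLp.toLp _), Submodule.le_topologicalClosure _ (Submodule.subset_span
    ⟨φ, hφ, hφLp.coeFn_toLp, hgradLp.coeFn_toLp⟩)⟩, hφLp.coeFn_toLp⟩

theorem poincareNorm_nonneg (v : W01p Ω p) : 0 ≤ poincareNorm v :=
  Real.rpow_nonneg (by positivity) _

theorem integral_norm_grad_rpow (v : W01p Ω p) :
    ∫ x in Ω, ‖grad v x‖ ^ p = poincareNorm v ^ p := by
  have hp : 1 < p := Fact.out
  rw [poincareNorm, one_div, Real.rpow_inv_rpow (by positivity) (by positivity)]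

theorem poincareNorm_eq_norm (v : W01p Ω p) : poincareNorm v = ‖v.1.2‖ := by
  have hp : 1 < p := Fact.out
  rw [Lp.norm_def, toReal_eLpNorm (Lp.aestronglyMeasurable _),
    lpNorm_eq_integral_norm_rpow_toReal (by simpa using by positivity) ENNReal.ofReal_ne_top
      (Lp.aestronglyMeasurable _), ENNReal.toReal_ofReal (by positivity), poincareNorm, one_div]
  rfl

theorem poincareNorm_smul (t : ℝ) (v : W01p Ω p) :
    poincareNorm (t • v) = |t| * poincareNorm v := by
  rw [poincareNorm_eq_norm, poincareNorm_eq_norm]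
  exact norm_smul t v.1.2

theorem fn_smul (t : ℝ) (v : W01p Ω p) :
    ∀ᵐ x ∂volume.restrict Ω, fn (t • v) x = t * fn v x :=
  Lp.coeFn_smul t v.1.1

theorem aestronglyMeasurable_fn (v : W01p Ω p) :
    AEStronglyMeasurable (fn v) (volume.restrict Ω) :=
  Lp.aestronglyMeasurable v.1.1

end SobolevSpace

section SobolevInequality

/-- The critical Sobolev exponent `p* = Np / (N - p)`, characterised by `1/p* = 1/p - 1/N`. -/
noncomputable def sobolevExponent (N : ℕ) (p : ℝ) : ℝ := (p⁻¹ - (N : ℝ)⁻¹)⁻¹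

variable {N : ℕ} {Ω : Set (EuclideanSpace ℝ (Fin N))} {p : ℝ}

theorem sobolevExponent_pos (hp : 0 < p) (hpN : p < N) : 0 < sobolevExponent N p :=
  inv_pos.2 (sub_pos.2 (inv_strictAnti₀ hp hpN))

theorem one_le_sobolevExponent (hp : 1 ≤ p) (hpN : p < N) : 1 ≤ sobolevExponent N p := by
  have hp0 : 0 < p := zero_lt_one.trans_le hp
  refine (one_le_inv₀ (sub_pos.2 (inv_strictAnti₀ hp0 hpN))).2 ?_
  linarith [inv_le_one_of_one_le₀ hp, inv_nonneg.2 (Nat.cast_nonneg (α := ℝ) N)]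

theorem IsTestFunction.eLpNorm_le_eLpNorm_gradient {φ : EuclideanSpace ℝ (Fin N) → ℝ}
    (hφ : IsTestFunction Ω φ) (hp : 1 ≤ p) (hpN : p < N) :
    eLpNorm φ (ENNReal.ofReal (sobolevExponent N p)) (volume.restrict Ω) ≤
      SNormLESNormFDerivOfEqConst ℝ (volume : Measure (EuclideanSpace ℝ (Fin N))) p.toNNReal *
        eLpNorm (gradient φ) (ENNReal.ofReal p) (volume.restrict Ω) := by
  have hp0 : 0 < p := zero_lt_one.trans_le hp
  have hN : 0 < N := Nat.cast_pos.1 (hp0.trans hpN)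
  rw [eLpNorm_restrict_eq_of_support_subset ((subset_tsupport φ).trans hφ.2.2),
    eLpNorm_restrict_eq_of_support_subset ((support_gradient_subset_tsupport φ).trans hφ.2.2),
    eLpNorm_congr_norm_ae (Eventually.of_forall (norm_gradient φ))]
  refine eLpNorm_le_eLpNorm_fderiv_of_eq volume (hφ.1.of_le (by simp)) hφ.2.1
    (p' := (sobolevExponent N p).toNNReal) (Real.one_le_toNNReal.2 hp)
    (by rwa [finrank_euclideanSpace_fin]) ?_
  rw [Real.coe_toNNReal _ (sobolevExponent_pos hp0 hpN).le, NNReal.coe_inv,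
    Real.coe_toNNReal _ hp0.le, finrank_euclideanSpace_fin, sobolevExponent, inv_inv]

variable [Fact (1 < p)]

variable (Ω p) in
theorem exists_eLpNorm_fn_le (hpN : p < N) :
    ∃ C : NNReal, ∀ v : W01p Ω p,
      eLpNorm (fn v) (ENNReal.ofReal (sobolevExponent N p)) (volume.restrict Ω) ≤
        C * ENNReal.ofReal (poincareNorm v) := by
  have hp : 1 < p := Fact.out
  refine ⟨SNormLESNormFDerivOfEqConst ℝ (volume : Measure (EuclideanSpace ℝ (Fin N))) p.toNNReal,
    fun v ↦ ?_⟩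
  obtain ⟨z, hz, hlim⟩ := mem_closure_iff_seq_limit.1 v.2
  rw [poincareNorm_eq_norm]
  refine eLpNorm_le_of_tendsto_Lp ((continuous_fst.tendsto _).comp hlim)
    (ENNReal.Tendsto.const_mul (ENNReal.tendsto_ofReal
      (((continuous_snd.norm).tendsto _).comp hlim)) (Or.inr ENNReal.coe_ne_top)) fun n ↦ ?_
  obtain ⟨φ, hφ, hzφ, hzφ'⟩ := mem_span_testPairs_iff.1 (hz n)
  simp only [Function.comp_apply]
  rw [Lp.norm_def, ENNReal.ofReal_toReal (Lp.eLpNorm_ne_top _), eLpNorm_congr_ae hzφ,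
    eLpNorm_congr_ae hzφ']
  exact hφ.eLpNorm_le_eLpNorm_gradient hp.le hpN

theorem memLp_fn (hpN : p < N) (v : W01p Ω p) :
    MemLp (fn v) (ENNReal.ofReal (sobolevExponent N p)) (volume.restrict Ω) := by
  obtain ⟨C, hC⟩ := exists_eLpNorm_fn_le Ω p hpN
  exact ⟨aestronglyMeasurable_fn v,
    (hC v).trans_lt (ENNReal.mul_lt_top ENNReal.coe_lt_top ENNReal.ofReal_lt_top)⟩

variable (Ω p) in
theorem exists_lpNorm_fn_le (hpN : p < N) :
    ∃ C : NNReal, ∀ v : W01p Ω p,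
      lpNorm (fn v) (ENNReal.ofReal (sobolevExponent N p)) (volume.restrict Ω) ≤
        C * poincareNorm v := by
  obtain ⟨C, hC⟩ := exists_eLpNorm_fn_le Ω p hpN
  refine ⟨C, fun v ↦ ?_⟩
  have hv := poincareNorm_nonneg v
  rw [← ENNReal.ofReal_le_ofReal_iff (by positivity), ofReal_lpNorm (memLp_fn hpN v),
    ENNReal.ofReal_mul C.coe_nonneg, ENNReal.ofReal_coe_nnreal]
  exact hC v

theorem fn_ae_eq_zero_of_poincareNorm_eq_zero (hpN : p < N) {v : W01p Ω p}
    (hv : poincareNorm v = 0) : fn v =ᵐ[volume.restrict Ω] 0 := by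
  have hp : 1 < p := Fact.out
  obtain ⟨C, hC⟩ := exists_lpNorm_fn_le Ω p hpN
  have hzero := (hC v).antisymm (by simp [hv])
  rw [hv, mul_zero] at hzero
  refine (lpNorm_eq_zero (memLp_fn hpN v) ?_).1 hzero
  simpa using sobolevExponent_pos (zero_lt_one.trans hp) hpN

end SobolevInequality

section SubcriticalGrowth

/-- The exponent `p* / k'`, with `k'` conjugate to `k`: the largest `r` for which Hölder's
inequality and the Sobolev embedding make `|c| |v|^r` integrable for all `c ∈ L^k(Ω)` and
`v ∈ W_0^{1,p}(Ω)`. -/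
noncomputable def criticalGrowth (N : ℕ) (p k : ℝ) : ℝ := (1 - k⁻¹) * sobolevExponent N p

variable {N : ℕ} {p k : ℝ}

theorem lt_criticalGrowth (hp : 0 < p) (hpN : p < N) (hk : N / p < k) :
    p < criticalGrowth N p k := by
  have hk' : k⁻¹ < p / N := by
    rw [← inv_div]
    exact inv_strictAnti₀ (div_pos (hp.trans hpN) hp) hk
  rw [criticalGrowth, sobolevExponent, ← div_eq_mul_inv,
    lt_div_iff₀ (sub_pos.2 (inv_strictAnti₀ hp hpN)), mul_sub, mul_inv_cancel₀ hp.ne',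
    ← div_eq_mul_inv]
  exact sub_lt_sub_left hk' 1

theorem mul_criticalGrowth {k' : ℝ} (hk : k.HolderConjugate k') :
    k' * criticalGrowth N p k = sobolevExponent N p := by
  rw [criticalGrowth, hk.one_sub_inv, mul_inv_cancel_left₀ hk.symm.ne_zero]

theorem one_lt_of_div_lt (hp : 0 < p) (hpN : p < N) (hk : N / p < k) : 1 < k :=
  ((one_lt_div hp).2 hpN).trans hk

variable {Ω : Set (EuclideanSpace ℝ (Fin N))} [IsFiniteMeasure (volume.restrict Ω)]
  [Fact (1 < p)] {c : EuclideanSpace ℝ (Fin N) → ℝ}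

theorem integrableOn_abs_mul_one_add_abs_fn_rpow (hpN : p < N) (hk : N / p < k)
    (hc : MemLp c (ENNReal.ofReal k) (volume.restrict Ω)) (v : W01p Ω p) :
    IntegrableOn (fun x ↦ |c x| * (1 + |fn v x|) ^ criticalGrowth N p k) Ω := by
  have hp : 0 < p := zero_lt_one.trans Fact.out
  have hkk' := Real.HolderConjugate.conjExponent (one_lt_of_div_lt hp hpN hk)
  have hw := memLp_one_add_abs (memLp_fn hpN v)
  rw [← mul_criticalGrowth hkk'] at hw
  have hint := integrable_abs_mul_abs_rpow hkk' (hp.trans (lt_criticalGrowth hp hpN hk)) hc hw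
  simp only [abs_one_add_abs] at hint
  exact hint

variable (Ω) in
theorem exists_integral_abs_mul_one_add_abs_fn_rpow_le (hpN : p < N) (hk : N / p < k) {ρ : ℝ}
    (hρ : 0 ≤ ρ) :
    ∃ K, 0 ≤ K ∧ ∀ c, MemLp c (ENNReal.ofReal k) (volume.restrict Ω) → ∀ v : W01p Ω p,
      poincareNorm v ≤ ρ →
      ∫ x in Ω, |c x| * (1 + |fn v x|) ^ criticalGrowth N p k ≤
        lpNorm c (ENNReal.ofReal k) (volume.restrict Ω) * K := by
  have hp : 1 < p := Fact.out
  have hp0 : 0 < p := zero_lt_one.trans hp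
  have hr := hp0.trans (lt_criticalGrowth hp0 hpN hk)
  have hkk' := Real.HolderConjugate.conjExponent (one_lt_of_div_lt hp0 hpN hk)
  obtain ⟨C, hC⟩ := exists_lpNorm_fn_le Ω p hpN
  set m := ENNReal.ofReal (sobolevExponent N p) with hm
  set B := lpNorm (fun _ : EuclideanSpace ℝ (Fin N) ↦ (1 : ℝ)) m (volume.restrict Ω)
  have hB : 0 ≤ B := lpNorm_nonneg
  refine ⟨(B + C * ρ) ^ criticalGrowth N p k, by positivity, fun c hc v hv ↦ ?_⟩
  have hw := memLp_one_add_abs (memLp_fn hpN v)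
  have hnorm : lpNorm (fun x ↦ 1 + |fn v x|) m (volume.restrict Ω) ≤ B + C * ρ := calc
    _ ≤ B + lpNorm (fn v) m (volume.restrict Ω) :=
        lpNorm_one_add_abs_le (ENNReal.one_le_ofReal.2 (one_le_sobolevExponent hp.le hpN))
          (memLp_fn hpN v)
    _ ≤ B + C * ρ := by
        gcongr
        exact (hC v).trans (by gcongr)
  rw [← mul_criticalGrowth hkk'] at hw hm
  have holder := integral_abs_mul_abs_rpow_le hkk' hr hc hw
  rw [← hm] at holder
  simp only [abs_one_add_abs] at holder
  refine holder.trans ?_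
  gcongr
  exacts [lpNorm_nonneg, lpNorm_nonneg]

variable (Ω) in
theorem exists_abs_integral_mul_comp_fn_le {ψ : ℝ → ℝ} (hpN : p < N) (hk : N / p < k)
    (hψ : ψ =O[⊤] fun s ↦ (1 + |s|) ^ criticalGrowth N p k) {ρ : ℝ} (hρ : 0 ≤ ρ) :
    ∃ K, 0 ≤ K ∧ ∀ c, MemLp c (ENNReal.ofReal k) (volume.restrict Ω) → ∀ v : W01p Ω p,
      poincareNorm v ≤ ρ →
      |∫ x in Ω, c x * ψ (fn v x)| ≤ K * lpNorm c (ENNReal.ofReal k) (volume.restrict Ω) := by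
  obtain ⟨A, hA, hψA⟩ := exists_abs_integral_mul_comp_le (ν := volume.restrict Ω) hψ
  obtain ⟨K, hK, hweight⟩ := exists_integral_abs_mul_one_add_abs_fn_rpow_le Ω hpN hk hρ
  refine ⟨A * K, mul_nonneg hA hK, fun c hc v hv ↦ ?_⟩
  calc |∫ x in Ω, c x * ψ (fn v x)|
      ≤ A * ∫ x in Ω, |c x| * (1 + |fn v x|) ^ criticalGrowth N p k :=
        hψA c (fn v) (integrableOn_abs_mul_one_add_abs_fn_rpow hpN hk hc v)
    _ ≤ A * (lpNorm c (ENNReal.ofReal k) (volume.restrict Ω) * K) := by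
        gcongr
        exact hweight c hc v hv
    _ = A * K * lpNorm c (ENNReal.ofReal k) (volume.restrict Ω) := by ring

end SubcriticalGrowth

section Energy

variable {N : ℕ} {p q μ k : ℝ} [Fact (1 < p)]

theorem G_isBigO_criticalGrowth (hpN : p < N) (hq : 0 < q) (hμ : 0 < μ) (hk : N / p < k) :
    G p q μ =O[⊤] fun s ↦ (1 + |s|) ^ criticalGrowth N p k :=
  G_isBigO Fact.out hq hμ (lt_criticalGrowth (zero_lt_one.trans Fact.out) hpN hk)

theorem F_isBigO_criticalGrowth (hpN : p < N) (hμ : 0 < μ) (hk : N / p < k) :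
    F p μ =O[⊤] fun s ↦ (1 + |s|) ^ criticalGrowth N p k :=
  (F_isBigO Fact.out hμ).trans <| isBigO_one_add_abs_rpow_mono
    (lt_criticalGrowth (zero_lt_one.trans Fact.out) hpN hk).le

variable {Ω : Set (EuclideanSpace ℝ (Fin N))} {c h : EuclideanSpace ℝ (Fin N) → ℝ}

section FiniteMeasure

variable [IsFiniteMeasure (volume.restrict Ω)]

theorem integrableOn_mul_G_fn (hpN : p < N) (hq : 0 < q) (hμ : 0 < μ) (hk : N / p < k)
    (hc : MemLp c (ENNReal.ofReal k) (volume.restrict Ω)) (v : W01p Ω p) :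
    IntegrableOn (fun x ↦ c x * G p q μ (fn v x)) Ω :=
  integrable_mul_comp_of_isBigO (continuous_G Fact.out hq hμ)
    (G_isBigO_criticalGrowth hpN hq hμ hk) hc.1 (aestronglyMeasurable_fn v)
    (integrableOn_abs_mul_one_add_abs_fn_rpow hpN hk hc v)

theorem integrableOn_mul_F_fn (hpN : p < N) (hμ : 0 < μ) (hk : N / p < k)
    (hh : MemLp h (ENNReal.ofReal k) (volume.restrict Ω)) (v : W01p Ω p) :
    IntegrableOn (fun x ↦ h x * F p μ (fn v x)) Ω :=
  integrable_mul_comp_of_isBigO (continuous_F Fact.out hμ)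
    (F_isBigO_criticalGrowth hpN hμ hk) hh.1 (aestronglyMeasurable_fn v)
    (integrableOn_abs_mul_one_add_abs_fn_rpow hpN hk hh v)

variable (Ω) in
theorem exists_le_energy_of_poincareNorm_eq (hpN : p < N) (hq : 0 < q) (hμ : 0 < μ)
    (hk : N / p < k) {ρ : ℝ} (hρ : 0 < ρ) :
    ∃ δ, 0 < δ ∧ ∀ c h, MemLp c (ENNReal.ofReal k) (volume.restrict Ω) →
      MemLp h (ENNReal.ofReal k) (volume.restrict Ω) →
      lpNorm c (ENNReal.ofReal k) (volume.restrict Ω) ≤ δ →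
      lpNorm h (ENNReal.ofReal k) (volume.restrict Ω) ≤ δ →
      ∀ v : W01p Ω p, poincareNorm v = ρ → ρ ^ p / (2 * p) ≤ energy q μ c h v := by
  have hp : 0 < p := zero_lt_one.trans Fact.out
  obtain ⟨A, hA, hG⟩ := exists_abs_integral_mul_comp_fn_le Ω hpN hk
    (G_isBigO_criticalGrowth hpN hq hμ hk) hρ.le
  obtain ⟨B, hB, hF⟩ := exists_abs_integral_mul_comp_fn_le Ω hpN hk
    (F_isBigO_criticalGrowth hpN hμ hk) hρ.le
  set δ := ρ ^ p / (2 * p) / (A + B + 1)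
  refine ⟨δ, by positivity, fun c h hc hh hcδ hhδ v hv ↦ ?_⟩
  have hGv : ∫ x in Ω, c x * G p q μ (fn v x) ≤ A * δ :=
    (le_abs_self _).trans ((hG c hc v hv.le).trans (by gcongr))
  have hFv : ∫ x in Ω, h x * F p μ (fn v x) ≤ B * δ :=
    (le_abs_self _).trans ((hF h hh v hv.le).trans (by gcongr))
  have hsmall : A * δ + B * δ ≤ ρ ^ p / (2 * p) := calc
    A * δ + B * δ ≤ (A + B + 1) * δ := by
        linarith [show 0 < δ by positivity]
    _ = ρ ^ p / (2 * p) := mul_div_cancel₀ _ (by positivity)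
  have hhalf : 1 / p * ρ ^ p = ρ ^ p / (2 * p) + ρ ^ p / (2 * p) := by
    field_simp
    norm_num
  rw [energy, integral_norm_grad_rpow, hv, hhalf]
  linarith

end FiniteMeasure

theorem energy_smul (q μ : ℝ) (c h : EuclideanSpace ℝ (Fin N) → ℝ) {t : ℝ} (ht : 0 ≤ t)
    (v : W01p Ω p) :
    energy q μ c h (t • v) = t ^ p * (1 / p * poincareNorm v ^ p)
      - (∫ x in Ω, c x * G p q μ (t * fn v x)) - ∫ x in Ω, h x * F p μ (t * fn v x) := by
  have hG : ∫ x in Ω, c x * G p q μ (fn (t • v) x) = ∫ x in Ω, c x * G p q μ (t * fn v x) :=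
    integral_congr_ae ((fn_smul t v).mono fun x hx ↦ by simp only [hx])
  have hF : ∫ x in Ω, h x * F p μ (fn (t • v) x) = ∫ x in Ω, h x * F p μ (t * fn v x) :=
    integral_congr_ae ((fn_smul t v).mono fun x hx ↦ by simp only [hx])
  rw [energy, integral_norm_grad_rpow, poincareNorm_smul, abs_of_nonneg ht,
    Real.mul_rpow ht (poincareNorm_nonneg v), hG, hF, mul_left_comm]

theorem tendsto_energy_smul_atBot [IsFiniteMeasure (volume.restrict Ω)] (hpN : p < N)
    (hq : 0 < q) (hμ : 0 < μ) (hk : N / p < k)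
    (hc : MemLp c (ENNReal.ofReal k) (volume.restrict Ω))
    (hh : MemLp h (ENNReal.ofReal k) (volume.restrict Ω))
    (hc0 : ∀ᵐ x ∂volume.restrict Ω, 0 ≤ c x) {v : W01p Ω p}
    (hv : ∀ᵐ x ∂volume.restrict Ω, 0 ≤ fn v x)
    (hcv : ¬ ∀ᵐ x ∂volume.restrict Ω, c x * fn v x = 0) :
    Tendsto (fun t : ℝ ↦ energy q μ c h (t • v)) atTop atBot := by
  have hp : 1 < p := Fact.out
  have hp0 : 0 < p := zero_lt_one.trans hp
  have hcG : ∀ t : ℝ, IntegrableOn (fun x ↦ c x * G p q μ (t * fn v x)) Ω := fun t ↦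
    (integrableOn_mul_G_fn hpN hq hμ hk hc (t • v)).congr
      ((fn_smul t v).mono fun x hx ↦ by simp only [hx])
  have hG := tendsto_integral_mul_comp_smul_div_rpow_atTop (G_monotoneOn hp.le hq hμ)
    (by simp [G]) (tendsto_G_div_rpow_atTop hp hq hμ) hc0 hv hcv hcG
  obtain ⟨C, hC⟩ := (isBigO_integral_mul_comp_smul hp0.le (lt_criticalGrowth hp0 hpN hk).le
    (F_isBigO hp hμ) (integrableOn_abs_mul_one_add_abs_fn_rpow hpN hk hh v)).bound
  have hbracket := tendsto_atBot_add_const_left _ (1 / p * poincareNorm v ^ p + C)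
    (tendsto_neg_atTop_atBot.comp hG)
  refine tendsto_atBot_mono' _ ?_ ((tendsto_rpow_atTop hp0).atTop_mul_atBot₀ hbracket)
  filter_upwards [eventually_gt_atTop 0, hC] with t ht hFt
  have htp : 0 < t ^ p := Real.rpow_pos_of_pos ht p
  rw [Real.norm_of_nonneg htp.le] at hFt
  rw [energy_smul q μ c h ht.le]
  calc t ^ p * (1 / p * poincareNorm v ^ p) - (∫ x in Ω, c x * G p q μ (t * fn v x))
        - ∫ x in Ω, h x * F p μ (t * fn v x)
      ≤ t ^ p * (1 / p * poincareNorm v ^ p) - (∫ x in Ω, c x * G p q μ (t * fn v x))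
        + C * t ^ p := by
        rw [sub_eq_add_neg _ (∫ x in Ω, h x * F p μ (t * fn v x))]
        gcongr
        exact (neg_le_abs _).trans hFt
    _ = _ := by
        simp only [Function.comp_apply]
        field_simp
        ring

theorem exists_fn_nonneg_and_mul_fn_ne_zero (hΩ : IsOpen Ω)
    (hc : ¬ ∀ᵐ x ∂volume.restrict Ω, c x = 0) :
    ∃ v : W01p Ω p, (∀ᵐ x ∂volume.restrict Ω, 0 ≤ fn v x) ∧
      ¬ ∀ᵐ x ∂volume.restrict Ω, c x * fn v x = 0 := by
  rw [ae_iff, Measure.restrict_apply' hΩ.measurableSet] at hc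
  -- a bump function at a point of `Ω` near which `c` is not a.e. zero
  obtain ⟨x, hx, hxpos⟩ := exists_mem_forall_mem_nhdsWithin_pos_measure hc
  obtain ⟨φ, hsupp, hcompact, hsmooth, hrange, hφx⟩ :=
    exists_contDiff_tsupport_subset (n := ⊤) (hΩ.mem_nhds hx.2)
  obtain ⟨v, hv⟩ := IsTestFunction.exists_fn_ae_eq (p := p) ⟨hsmooth, hcompact, hsupp⟩
  refine ⟨v, hv.mono fun y hy ↦ hy ▸ (hrange ⟨y, rfl⟩).1, fun hzero ↦ ?_⟩
  have hnhds : {y | 0 < φ y} ∈ 𝓝 x :=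
    (isOpen_lt continuous_const hsmooth.continuous).mem_nhds (by simp [hφx])
  have hφzero : ∀ᵐ y ∂volume.restrict Ω, c y * φ y = 0 := by
    filter_upwards [hzero, hv] with y hy hvy
    rwa [← hvy]
  rw [ae_iff, Measure.restrict_apply' hΩ.measurableSet] at hφzero
  refine (hxpos _ (inter_mem_nhdsWithin _ hnhds)).ne' (measure_mono_null ?_ hφzero)
  rintro y ⟨⟨hcy, hyΩ⟩, hφy⟩
  exact ⟨mul_ne_zero hcy (ne_of_gt hφy), hyΩ⟩

theorem poincareNorm_pos_of_mul_fn_ne_zero (hpN : p < N) {v : W01p Ω p}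
    (hcv : ¬ ∀ᵐ x ∂volume.restrict Ω, c x * fn v x = 0) : 0 < poincareNorm v := by
  refine (poincareNorm_nonneg v).lt_of_ne fun hzero ↦ hcv ?_
  filter_upwards [fn_ae_eq_zero_of_poincareNorm_eq_zero hpN hzero.symm] with x hx
  rw [hx, Pi.zero_apply, mul_zero]

theorem exists_lt_poincareNorm_and_energy_nonpos {v : W01p Ω p} (hv : 0 < poincareNorm v)
    (hlim : Tendsto (fun t : ℝ ↦ energy q μ c h (t • v)) atTop atBot) (ρ : ℝ) :
    ∃ v₀ : W01p Ω p, ρ < poincareNorm v₀ ∧ energy q μ c h v₀ ≤ 0 := by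
  obtain ⟨t, hρt, ht, hle⟩ := ((eventually_gt_atTop (ρ / poincareNorm v)).and
    ((eventually_ge_atTop 0).and (hlim.eventually_le_atBot 0))).exists
  refine ⟨t • v, ?_, hle⟩
  rw [poincareNorm_smul, abs_of_nonneg ht]
  exact (div_lt_iff₀ hv).1 hρt

end Energy

end PGradient

open PGradient in
theorem proposition2p1_general {N : ℕ} (Ω : Set (EuclideanSpace ℝ (Fin N)))
    (hΩo : IsOpen Ω) (hΩ : volume Ω ≠ ⊤)
    (p : ℝ) [Fact (1 < p)] (hpN : p < N) (q : ℝ) (hq : 0 < q) (μ : ℝ) (hμ : 0 < μ)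
    (k : ℝ) (hk : N / p < k) :
    ∃ δ : ℝ, 0 < δ ∧ ∀ c h : EuclideanSpace ℝ (Fin N) → ℝ,
      MemLp c (ENNReal.ofReal k) (volume.restrict Ω) →
      MemLp h (ENNReal.ofReal k) (volume.restrict Ω) →
      (∀ᵐ x ∂volume.restrict Ω, 0 ≤ c x) →
      (¬ ∀ᵐ x ∂volume.restrict Ω, c x = 0) →
      eLpNorm c (ENNReal.ofReal k) (volume.restrict Ω) < ENNReal.ofReal δ →
      eLpNorm h (ENNReal.ofReal k) (volume.restrict Ω) < ENNReal.ofReal δ →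
      (∀ v : W01p Ω p,
        IntegrableOn (fun x ↦ c x * G p q μ (fn v x)) Ω ∧
        IntegrableOn (fun x ↦ h x * F p μ (fn v x)) Ω) ∧
      (∃ ρ : ℝ, 0 < ρ ∧
        (∃ β : ℝ, 0 < β ∧ ∀ v : W01p Ω p, poincareNorm v = ρ →
          β ≤ energy q μ c h v) ∧
        ∃ v₀ : W01p Ω p, ρ < poincareNorm v₀ ∧ energy q μ c h v₀ ≤ 0) ∧
      (∀ v : W01p Ω p, (∀ᵐ x ∂volume.restrict Ω, 0 ≤ fn v x) →
        (¬ ∀ᵐ x ∂volume.restrict Ω, c x * fn v x = 0) →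
        Tendsto (fun t : ℝ ↦ energy q μ c h (t • v)) atTop atBot) := by
  have : IsFiniteMeasure (volume.restrict Ω) := isFiniteMeasure_restrict.2 hΩ
  have hp : 0 < p := zero_lt_one.trans Fact.out
  obtain ⟨δ, hδ, hsphere⟩ := exists_le_energy_of_poincareNorm_eq Ω hpN hq hμ hk one_pos
  refine ⟨δ, hδ, fun c h hc hh hc0 hcne hcδ hhδ ↦ ?_⟩
  have hcδ' := ENNReal.toReal_le_of_le_ofReal hδ.le hcδ.le
  have hhδ' := ENNReal.toReal_le_of_le_ofReal hδ.le hhδ.le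
  rw [toReal_eLpNorm hc.1] at hcδ'
  rw [toReal_eLpNorm hh.1] at hhδ'
  have hlim (v : W01p Ω p) := tendsto_energy_smul_atBot (v := v) hpN hq hμ hk hc hh hc0
  refine ⟨fun v ↦ ⟨integrableOn_mul_G_fn hpN hq hμ hk hc v, integrableOn_mul_F_fn hpN hμ hk hh v⟩,
    ⟨1, one_pos, ⟨1 ^ p / (2 * p), by positivity, hsphere c h hc hh hcδ' hhδ'⟩, ?_⟩, hlim⟩
  obtain ⟨v, hv, hcv⟩ := exists_fn_nonneg_and_mul_fn_ne_zero (p := p) hΩo hcne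
  exact exists_lt_poincareNorm_and_energy_nonpos
    (poincareNorm_pos_of_mul_fn_ne_zero hpN hcv) (hlim v hv hcv) 1

theorem proposition2p1 {N : ℕ} (hN : 3 ≤ N) (Ω : Set (EuclideanSpace ℝ (Fin N)))
    (hΩo : IsOpen Ω) (hΩb : Bornology.IsBounded Ω)
    (p : ℝ) [Fact (1 < p)] (hpN : p < N) (q : ℝ) (hq : 0 < q) (μ : ℝ) (hμ : 0 < μ)
    (k : ℝ) (hk : N / p < k) :
    ∃ δ : ℝ, 0 < δ ∧ ∀ c h : EuclideanSpace ℝ (Fin N) → ℝ,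
      MemLp c (ENNReal.ofReal k) (volume.restrict Ω) →
      MemLp h (ENNReal.ofReal k) (volume.restrict Ω) →
      (∀ᵐ x ∂volume.restrict Ω, 0 ≤ c x) →
      (¬ ∀ᵐ x ∂volume.restrict Ω, c x = 0) →
      eLpNorm c (ENNReal.ofReal k) (volume.restrict Ω) < ENNReal.ofReal δ →
      eLpNorm h (ENNReal.ofReal k) (volume.restrict Ω) < ENNReal.ofReal δ →
      -- the functional is well defined on the whole space
      (∀ v : PGradient.W01p Ω p,
        IntegrableOn (fun x => c x * PGradient.G p q μ (PGradient.fn v x)) Ω ∧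
        IntegrableOn (fun x => h x * PGradient.F p μ (PGradient.fn v x)) Ω) ∧
      -- mountain-pass geometry
      (∃ ρ : ℝ, 0 < ρ ∧
        (∃ β : ℝ, 0 < β ∧ ∀ v : PGradient.W01p Ω p, PGradient.poincareNorm v = ρ →
          β ≤ PGradient.energy q μ c h v) ∧
        ∃ v₀ : PGradient.W01p Ω p, ρ < PGradient.poincareNorm v₀ ∧ PGradient.energy q μ c h v₀ ≤ 0) ∧
      -- the functional tends to `-∞` along nonnegative directions `v` with `c v ≢ 0`
      (∀ v : PGradient.W01p Ω p, (∀ᵐ x ∂volume.restrict Ω, 0 ≤ PGradient.fn v x) →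
        (¬ ∀ᵐ x ∂volume.restrict Ω, c x * PGradient.fn v x = 0) →
        Tendsto (fun t : ℝ => PGradient.energy q μ c h (t • v)) atTop atBot) :=
  proposition2p1_general Ω hΩo hΩb.measure_lt_top.ne p hpN q hq μ hμ k hk
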